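/- For an integer $n\ge 1$ and $1\le k\le n$ let $\mathcal P_n^{(k)}$ be the set of $n\times k$ matrices whose columns are $k$ different columns of the $n\times n$ identity matrix. The rank expansion of $A\in\mathbb C^{m\times n}$ is $\tilde\sigma_A(k)=\min_{P\in\mathcal P_n^{(k)}}\operatorname{rank}(AP)$, $k\in\{1,\dots,n\}$. A rank expansion lower bound for $A$ is a continuous, nonnegative, (weakly) increasing function $\sigma:[0,\infty)\to\mathbb R$ such that $\sigma(k)\le\tilde\sigma_A(k)$ for all $k\in\{1,\dots,n\}$. For an increasing function $f$ on $[0,\infty)$ put $f^\dagger(x)=\sup\{k\ge 0: f(k)\le x\}$. Theorem. Let $A\in\mathbb C^{m_A\times n_A}$ and $B\in\mathbb C^{m_B\times n_B}$, and let $\sigma_A$ and $\sigma_B$ be concave rank expansion lower bounds for $A$ and $B$, respectively, with $\sigma_A(0)=\sigma_B(0)=0$. Let $d_A=\sigma_A^\dagger(1)$ and $d_B=\sigma_B^\dagger(1)$, and suppose that $d_A$ and $d_B$ are finite. Then for every real $k\ge 0$ the minimum $$\sigma_C(k)=\min\{\sigma_A(k_A)\,\sigma_B(k_B) : k_A\ge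 d_A,\ k_B\ge d_B,\ k_Ak_B\ge k\}$$ (over real $k_A,k_B$) is attained, and $\sigma_C$ is a rank expansion lower bound for the Kronecker product $A\otimes B$. -/

import Mathlib

open scoped Kronecker

/-- The `n × k` matrices made of `k` different columns of the `n × n` identity matrix. -/
def columnSelections (n : Type*) [DecidableEq n] (k : ℕ) : Set (Matrix n (Fin k) ℂ) :=
  {P | ∃ e : Fin k ↪ n, P = (1 : Matrix n n ℂ).submatrix id e}

/-- The rank expansion of `A`: the least rank of `A * P` over all selections `P` of `k` different
columns. It is used only for `1 ≤ k ≤ (number of columns of A)`, where the minimum is over a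
nonempty set. -/
noncomputable def rankExpansion {m n : Type*} [Fintype n] [DecidableEq n]
    (A : Matrix m n ℂ) (k : ℕ) : ℕ :=
  sInf ((fun P : Matrix n (Fin k) ℂ => (A * P).rank) '' columnSelections n k)

/-- `σ`, viewed as a function on the nonnegative reals, is a rank expansion lower bound for `A`.
"Increasing" is meant in the weak sense. -/
structure IsRankExpansionLowerBound {m n : Type*} [Fintype n] [DecidableEq n]
    (A : Matrix m n ℂ) (σ : ℝ → ℝ) : Prop where
  continuousOn : ContinuousOn σ (Set.Ici 0)
  nonneg : ∀ x : ℝ, 0 ≤ x → 0 ≤ σ x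
  monotoneOn : MonotoneOn σ (Set.Ici 0)
  le_rankExpansion : ∀ k : ℕ, 1 ≤ k → k ≤ Fintype.card n → σ k ≤ rankExpansion A k

/-- The set `{k ≥ 0 : f k ≤ x}`, whose supremum is the pseudoinverse of `f` at `x`. -/
def sublevel (f : ℝ → ℝ) (x : ℝ) : Set ℝ := {k | 0 ≤ k ∧ f k ≤ x}

/-- The pseudoinverse `f†(x) = sup {k ≥ 0 : f k ≤ x}` of an increasing function on the nonnegative
reals; meaningful when it is finite, that is, when `sublevel f x` is bounded above. -/
noncomputable def pseudoinverse (f : ℝ → ℝ) (x : ℝ) : ℝ := sSup (sublevel f x)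

/-- The values `σA kA * σB kB` over all `kA ≥ σA†(1)`, `kB ≥ σB†(1)` with `kA * kB ≥ k`. -/
def kroneckerValues (σA σB : ℝ → ℝ) (k : ℝ) : Set ℝ :=
  {v | ∃ kA kB : ℝ, pseudoinverse σA 1 ≤ kA ∧ pseudoinverse σB 1 ≤ kB ∧ k ≤ kA * kB ∧
    v = σA kA * σB kB}

/-- `σC(k) = min {σA kA * σB kB : kA ≥ σA†(1), kB ≥ σB†(1), kA * kB ≥ k}`. -/
noncomputable def kroneckerBound (σA σB : ℝ → ℝ) (k : ℝ) : ℝ := sInf (kroneckerValues σA σB k)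

/-!
Put `a = σA†(1)` and `b = σB†(1)`, so that `σA a = σB b = 1` and `a, b > 0`.

*Ranks.* Select `k` columns of `A ⊗ B`, that is, a set `S` of pairs `(i, j)` with rows
`S i = {j | (i, j) ∈ S}` of sizes `s i`. Growing an independent family through the superlevel sets
of `s` gives a set `I` of independent columns of `A` whose members in each superlevel set
`{i | y < s i}` span all the columns in it (`exists_linearIndepOn_span_superlevel`). Tensoring every column in `I`
with a basis of the columns of `B` in its row keeps independence (`linearIndepOn_kronecker_col`), so
the rank is at least the sum over `i ∈ I` of the ranks of the rows. A rank is an integer, hence at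
least `1` on nonempty sets, so every rank bound `σ c` improves to `σ (max c d)`, where `σ d = 1`
(`IsRankExpansionLowerBound.apply_max_le_card`).

*Geometry.* The resulting lower bound is the cost of a staircase of area at least `k` for the
product of the two gauges. In terms of its layers above the height `b`, the cost is a concave
function, so by Jensen's inequality it is at least a convex combination of costs of two-step
regions of at least the same area (`le_cost_staircase`). The same argument in the other direction reduces
these to rectangles and L-shapes (`le_cost_twoStep`), and L-shapes to rectangles with one side `a`
or `b` (`le_cost_lshape`). The cost of a rectangle is one of the values over which the minimum
is taken.

*Minimum.* For `k` in a bounded range the minimum can be taken over a fixed compact interval of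
widths, with an objective jointly continuous in `k` and the width. This gives both attainment and
continuity (`exists_continuous_isLeast_kroneckerValues`).
-/

/-! ### The pseudoinverse at one -/

/-- For a continuous `f` with `f 0 = 0` whose sublevel set at `1` is bounded, `f` takes the value
`1` at its pseudoinverse. -/
lemma apply_pseudoinverse_one {f : ℝ → ℝ} (hf : ContinuousOn f (Set.Ici 0)) (h0 : f 0 = 0)
    (hbdd : BddAbove (sublevel f 1)) :
    0 < pseudoinverse f 1 ∧ f (pseudoinverse f 1) = 1 := by
  have hmem0 : (0 : ℝ) ∈ sublevel f 1 := ⟨le_rfl, by simp [h0]⟩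
  have hclosed : IsClosed (sublevel f 1) :=
    hf.preimage_isClosed_of_isClosed isClosed_Ici isClosed_Iic
  obtain ⟨hd0, hd1⟩ : pseudoinverse f 1 ∈ sublevel f 1 := hclosed.csSup_mem ⟨0, hmem0⟩ hbdd
  set d := pseudoinverse f 1 with hd
  have hone : f d = 1 := by
    refine le_antisymm hd1 ?_
    have htends : Filter.Tendsto f (nhdsWithin d (Set.Ioi d)) (nhds (f d)) :=
      (hf d hd0).mono_left (nhdsWithin_mono _ fun x hx => hd0.trans (le_of_lt hx))
    refine ge_of_tendsto htends (eventually_nhdsWithin_of_forall fun x hx => ?_)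
    by_contra! h
    exact absurd (le_csSup hbdd ⟨hd0.trans (le_of_lt hx), h.le⟩) (not_le.2 hx)
  refine ⟨lt_of_le_of_ne hd0 fun h => ?_, hone⟩
  rw [← h, h0] at hone
  exact zero_ne_one hone

lemma ConcaveOn.pos_of_apply_eq_one {f : ℝ → ℝ} {a x : ℝ} (hf : ConcaveOn ℝ (Set.Ici 0) f)
    (hmono : MonotoneOn f (Set.Ici 0)) (h0 : f 0 = 0) (ha : 0 < a) (hfa : f a = 1) (hx : 0 < x) :
    0 < f x := by
  rcases le_total a x with h | h
  · exact one_pos.trans_le (hfa ▸ hmono ha.le hx.le h)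
  · have hxa : 0 < x / a := div_pos hx ha
    have := hf.2 (x := 0) (y := a) (Set.mem_Ici.2 le_rfl) (Set.mem_Ici.2 ha.le)
      (sub_nonneg.2 ((div_le_one ha).2 h)) hxa.le (by ring)
    simp only [smul_eq_mul, h0, hfa, mul_zero, zero_add, mul_one, div_mul_cancel₀ x ha.ne'] at this
    exact hxa.trans_le this

/-! ### Rectangles minimize the product of concave gauges -/

/-- The L-shaped region `[0, a] × [0, y] ∪ [0, x] × [0, b]`, of area `a * y + b * x - a * b`, costs
at least as much as some rectangle of at least its area. -/
lemma le_cost_lshape {f g : ℝ → ℝ} {a b x y k M : ℝ} (hf : ConcaveOn ℝ (Set.Ici 0) f)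
    (hg : ConcaveOn ℝ (Set.Ici 0) g) (ha : 0 < a) (hb : 0 < b) (hfa : f a = 1) (hgb : g b = 1)
    (hM : ∀ u v, a ≤ u → b ≤ v → k ≤ u * v → M ≤ f u * g v)
    (hx : a ≤ x) (hy : b ≤ y) (hk : k ≤ a * y + b * x - a * b) : M ≤ f x + g y - 1 := by
  obtain ⟨p, rfl⟩ : ∃ p, x = a + p := ⟨x - a, by ring⟩
  obtain ⟨q, rfl⟩ : ∃ q, y = b + q := ⟨y - b, by ring⟩
  have hp : 0 ≤ p := by linarith
  have hq : 0 ≤ q := by linarith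
  set Z := b * p + a * q with hZ
  rcases (show 0 ≤ Z by positivity).eq_or_lt with h | h
  · have hp0 : p = 0 := by nlinarith [mul_nonneg hb.le hp, mul_nonneg ha.le hq]
    have hq0 : q = 0 := by nlinarith [mul_nonneg hb.le hp, mul_nonneg ha.le hq]
    subst hp0 hq0
    have := hM a b le_rfl le_rfl (by linarith)
    simp only [add_zero, hfa, hgb] at this ⊢
    linarith
  -- With weights `b * p / Z` and `a * q / Z`, concavity compares the L-shape with the two
  -- rectangles obtained by moving all the extra area `Z` into one arm.
  · have hs : 0 ≤ b * p / Z := by positivity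
    have ht : 0 ≤ a * q / Z := by positivity
    have hst : b * p / Z + a * q / Z = 1 := by rw [← add_div, div_self h.ne']
    have hZb : 0 ≤ Z / b := by positivity
    have hZa : 0 ≤ Z / a := by positivity
    have h1 := hf.2 (x := a + Z / b) (y := a) (Set.mem_Ici.2 (by linarith))
      (Set.mem_Ici.2 ha.le) hs ht hst
    have h2 := hg.2 (x := b) (y := b + Z / a) (Set.mem_Ici.2 hb.le)
      (Set.mem_Ici.2 (by linarith)) hs ht hst
    have e1 : b * p / Z * (a + Z / b) + a * q / Z * a = a + p := by
      have : b * p / Z * (Z / b) = p := by field_simp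
      linear_combination a * hst + this
    have e2 : b * p / Z * b + a * q / Z * (b + Z / a) = b + q := by
      have : a * q / Z * (Z / a) = q := by field_simp
      linear_combination b * hst + this
    simp only [smul_eq_mul, hfa, hgb, e1, e2] at h1 h2
    have hP := hM (a + Z / b) b (by linarith) le_rfl
      (by rw [add_mul, div_mul_cancel₀ _ hb.ne']; linarith)
    have hQ := hM a (b + Z / a) le_rfl (by linarith)
      (by rw [mul_add, mul_div_cancel₀ _ ha.ne']; linarith)
    rw [hgb, mul_one] at hP
    rw [hfa, one_mul] at hQ
    have hP' := mul_le_mul_of_nonneg_left hP hs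
    have hQ' := mul_le_mul_of_nonneg_left hQ ht
    have hM' : M = b * p / Z * M + a * q / Z * M := by rw [← add_mul, hst, one_mul]
    linarith

/-- The two-step region `[0, x] × [0, y] ∪ [0, w] × [0, b]` costs at least as much as some
rectangle of at least its area: it interpolates between a rectangle of height `y` and an L-shape. -/
lemma le_cost_twoStep {f g : ℝ → ℝ} {a b x y w k M : ℝ} (hf : ConcaveOn ℝ (Set.Ici 0) f)
    (hg : ConcaveOn ℝ (Set.Ici 0) g) (hg_mono : MonotoneOn g (Set.Ici 0))
    (ha : 0 < a) (hb : 0 < b) (hfa : f a = 1) (hgb : g b = 1)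
    (hM : ∀ u v, a ≤ u → b ≤ v → k ≤ u * v → M ≤ f u * g v)
    (hx : a ≤ x) (hxw : x ≤ w) (hy : b ≤ y) (hk : k ≤ b * w + x * (y - b)) :
    M ≤ f x * (g y - 1) + f w := by
  have hy0 : 0 < y := hb.trans_le hy
  have hgy : 1 ≤ g y := hgb ▸ hg_mono hb.le hy0.le hy
  obtain ⟨p, rfl⟩ : ∃ p, x = a + p := ⟨x - a, by ring⟩
  obtain ⟨q, rfl⟩ : ∃ q, w = a + p + q := ⟨w - (a + p), by ring⟩
  have hp : 0 ≤ p := by linarith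
  have hq : 0 ≤ q := by linarith
  set U := y * p + b * q with hU
  rcases (show 0 ≤ U by positivity).eq_or_lt with h | h
  · have hp0 : p = 0 := by nlinarith [mul_nonneg hy0.le hp, mul_nonneg hb.le hq]
    have hq0 : q = 0 := by nlinarith [mul_nonneg hy0.le hp, mul_nonneg hb.le hq]
    subst hp0 hq0
    have := hM a y le_rfl hy (by linarith)
    simp only [add_zero, hfa] at this ⊢
    linarith
  · have hs : 0 ≤ y * p / U := by positivity
    have ht : 0 ≤ b * q / U := by positivity
    have hst : y * p / U + b * q / U = 1 := by rw [← add_div, div_self h.ne']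
    have hUy : 0 ≤ U / y := by positivity
    have hUb : 0 ≤ U / b := by positivity
    have h1 := hf.2 (x := a + U / y) (y := a) (Set.mem_Ici.2 (by linarith))
      (Set.mem_Ici.2 ha.le) hs ht hst
    have h2 := hf.2 (x := a + U / y) (y := a + U / b) (Set.mem_Ici.2 (by linarith))
      (Set.mem_Ici.2 (by linarith)) hs ht hst
    have e0 : y * p / U * (U / y) = p := by field_simp
    have e1 : y * p / U * (a + U / y) + b * q / U * a = a + p := by
      linear_combination a * hst + e0
    have e2 : y * p / U * (a + U / y) + b * q / U * (a + U / b) = a + p + q := by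
      have : b * q / U * (U / b) = q := by field_simp
      linear_combination a * hst + e0 + this
    simp only [smul_eq_mul, hfa, e1, e2] at h1 h2
    have hP := hM (a + U / y) y (by linarith) hy
      (by rw [add_mul, div_mul_cancel₀ _ hy0.ne']; linarith)
    have hQ := le_cost_lshape hf hg ha hb hfa hgb hM (x := a + U / b) (y := y) (by linarith) hy
      (by rw [mul_add b, mul_div_cancel₀ _ hb.ne']; linarith)
    have h1' := mul_le_mul_of_nonneg_right h1 (sub_nonneg.2 hgy)
    have hP' := mul_le_mul_of_nonneg_left hP hs
    have hQ' := mul_le_mul_of_nonneg_left hQ ht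
    have hM' : M = y * p / U * M + b * q / U * M := by rw [← add_mul, hst, one_mul]
    linarith

/-- The part of `s` above the height `b`, cut into horizontal layers of integral position. -/
lemma max_eq_add_sum_layers {b : ℝ} (hb : 0 ≤ b) {s H : ℕ} (hs : s ≤ H) :
    max (s : ℝ) b = b + ∑ y ∈ Finset.range H,
      if y < s then max ((y + 1 : ℕ) : ℝ) b - max (y : ℝ) b else 0 := by
  rw [← Finset.sum_filter]
  have : (Finset.range H).filter (· < s) = Finset.range s := by
    ext y; simp only [Finset.mem_filter, Finset.mem_range]; omega
  rw [this, Finset.sum_range_sub (fun y : ℕ => max (y : ℝ) b)]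
  simp [max_eq_right hb]

/-- The isoperimetric inequality for staircases. The staircase has steps indexed by `I`, with
heights `s i`; its layer at height `y` has width `x y`, and `f (x y)` is at most the number of steps
above `y`. By Jensen's inequality its cost is at least a convex combination of costs of two-step
regions. -/
lemma le_cost_staircase {ι : Type*} {f g : ℝ → ℝ} {a b k M : ℝ}
    (hf : ConcaveOn ℝ (Set.Ici 0) f) (hg : ConcaveOn ℝ (Set.Ici 0) g)
    (hg_mono : MonotoneOn g (Set.Ici 0))
    (ha : 0 < a) (hb : 0 < b) (hfa : f a = 1) (hgb : g b = 1)
    (hM : ∀ u v, a ≤ u → b ≤ v → k ≤ u * v → M ≤ f u * g v)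
    (I : Finset ι) (s : ι → ℕ) {H : ℕ} (hH : 0 < H) (hs : ∀ i ∈ I, s i ≤ H) (x : ℕ → ℝ)
    (hxa : ∀ y < H, a ≤ x y) (hx0 : ∀ y < H, x y ≤ x 0)
    (hfx : ∀ y < H, f (x y) ≤ (I.filter (y < s ·)).card)
    (hk : k ≤ b * x 0 + ∑ y ∈ Finset.range H,
      (max ((y + 1 : ℕ) : ℝ) b - max (y : ℝ) b) * x y) :
    M ≤ ∑ i ∈ I, g (max (s i : ℝ) b) := by
  set c : ℕ → ℝ := fun y => max ((y + 1 : ℕ) : ℝ) b - max (y : ℝ) b with hc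
  have hc0 : ∀ y, 0 ≤ c y := fun y => sub_nonneg.2 (max_le_max_right _ (by simp))
  set T := ∑ y ∈ Finset.range H, c y * x y with hT
  have hxpos : ∀ y ∈ Finset.range H, 0 < x y := fun y hy =>
    ha.trans_le (hxa y (Finset.mem_range.1 hy))
  have hcx : ∀ y ∈ Finset.range H, 0 ≤ c y * x y := fun y hy =>
    mul_nonneg (hc0 y) (hxpos y hy).le
  have hcard : f (x 0) ≤ I.card :=
    (hfx 0 hH).trans (by exact_mod_cast Finset.card_filter_le _ _)
  rcases (Finset.sum_nonneg hcx).eq_or_lt with h | h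
  · have hbase := hM (x 0) b (hxa 0 hH) le_rfl (by rw [← hT] at h; linarith)
    have : ∀ i ∈ I, 1 ≤ g (max (s i : ℝ) b) := fun i _ =>
      hgb ▸ hg_mono hb.le (hb.le.trans (le_max_right _ _)) (le_max_right _ _)
    have := Finset.sum_le_sum this
    simp only [Finset.sum_const, nsmul_eq_mul, mul_one] at this
    rw [hgb] at hbase
    linarith
  rw [← hT] at h
  set w : ℕ → ℝ := fun y => c y * x y / T with hw
  have hw0 : ∀ y ∈ Finset.range H, 0 ≤ w y := fun y hy => div_nonneg (hcx y hy) h.le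
  have hw1 : ∑ y ∈ Finset.range H, w y = 1 := by
    rw [hw, ← Finset.sum_div, div_self h.ne']
  have hTx : ∀ y ∈ Finset.range H, 0 ≤ T / x y := fun y hy => div_nonneg h.le (hxpos y hy).le
  have hjensen : ∀ i ∈ I, ∑ y ∈ Finset.range H, w y *
      (1 + if y < s i then g (b + T / x y) - 1 else 0) ≤ g (max (s i : ℝ) b) := by
    intro i hi
    have := hg.le_map_sum (t := Finset.range H) (w := w)
      (p := fun y => b + if y < s i then T / x y else 0) hw0 hw1 (fun y hy => by
        have := hTx y hy
        refine Set.mem_Ici.2 ?_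
        split_ifs <;> linarith)
    have e : ∑ y ∈ Finset.range H, w y • (b + if y < s i then T / x y else 0)
        = max (s i : ℝ) b := by
      rw [max_eq_add_sum_layers hb.le (hs i hi)]
      simp only [smul_eq_mul, mul_add, Finset.sum_add_distrib, ← Finset.sum_mul, hw1, one_mul]
      congr 1
      refine Finset.sum_congr rfl fun y hy => ?_
      have := hxpos y hy
      split_ifs
      · simp only [hw]; field_simp; rfl
      · simp
    rw [e] at this
    refine le_trans (Finset.sum_le_sum fun y _ => ?_) this
    rw [smul_eq_mul]
    split_ifs <;> simp [hgb]
  refine le_trans ?_ (Finset.sum_le_sum hjensen)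
  rw [Finset.sum_comm]
  have hlayer : ∀ y ∈ Finset.range H, w y * M ≤ ∑ i ∈ I, w y *
      (1 + if y < s i then g (b + T / x y) - 1 else 0) := by
    intro y hy
    have hyH := Finset.mem_range.1 hy
    have hg1 : 1 ≤ g (b + T / x y) :=
      hgb ▸ hg_mono hb.le (Set.mem_Ici.2 (by linarith [hTx y hy])) (by linarith [hTx y hy])
    have := le_cost_twoStep hf hg hg_mono ha hb hfa hgb hM (hxa y hyH) (hx0 y hyH)
      (y := b + T / x y) (by linarith [hTx y hy])
      (by rwa [add_sub_cancel_left, mul_div_cancel₀ _ (hxpos y hy).ne'])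
    rw [← Finset.mul_sum, Finset.sum_add_distrib, ← Finset.sum_filter]
    simp only [Finset.sum_const, nsmul_eq_mul, mul_one]
    refine mul_le_mul_of_nonneg_left ?_ (hw0 y hy)
    have := mul_le_mul_of_nonneg_right (hfx y hyH) (sub_nonneg.2 hg1)
    linarith
  calc M = ∑ y ∈ Finset.range H, w y * M := by rw [← Finset.sum_mul, hw1, one_mul]
    _ ≤ _ := Finset.sum_le_sum hlayer

/-! ### Ranks of selected columns -/

lemma mul_one_submatrix {m n : Type*} [Fintype n] [DecidableEq n] (A : Matrix m n ℂ) {k : ℕ}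
    (e : Fin k → n) : A * (1 : Matrix n n ℂ).submatrix id e = A.submatrix id e := by
  ext i j
  simp [Matrix.mul_apply, Matrix.one_apply]

/-- Columns that span all columns in `X` number at least the rank expansion of `#X`. -/
lemma rankExpansion_card_le {m n : Type*} [Fintype n] [DecidableEq n] (A : Matrix m n ℂ)
    (X J : Finset n) (h : A.col '' X ⊆ Submodule.span ℂ (A.col '' J)) :
    rankExpansion A X.card ≤ J.card := by
  classical
  let e : Fin X.card ↪ n := X.equivFin.symm.toEmbedding.trans (Function.Embedding.subtype _)
  have hle : rankExpansion A X.card ≤ (A.submatrix id e).rank :=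
    Nat.sInf_le ⟨_, ⟨e, rfl⟩, congrArg Matrix.rank (mul_one_submatrix A e)⟩
  refine hle.trans ?_
  rw [Matrix.rank_eq_finrank_span_cols]
  have hsub : Submodule.span ℂ (Set.range (A.submatrix id e).col) ≤
      Submodule.span ℂ ((J.image A.col : Finset (m → ℂ)) : Set (m → ℂ)) := by
    rw [Submodule.span_le, Finset.coe_image]
    rintro _ ⟨i, rfl⟩
    exact h ⟨e i, (X.equivFin.symm i).2, rfl⟩
  exact (Submodule.finrank_mono hsub).trans
    ((finrank_span_finset_le_card _).trans Finset.card_image_le)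

/-- The rank expansion at `k` is the rank of the columns in some set of `k` columns, so it bounds
the size of every independent family of columns in that set. -/
lemma exists_finset_card_le_rankExpansion {m n : Type*} [Fintype n] [DecidableEq n]
    (A : Matrix m n ℂ) {k : ℕ} (hk : k ≤ Fintype.card n) :
    ∃ S : Finset n, S.card = k ∧
      ∀ J ⊆ S, LinearIndepOn ℂ A.col (J : Set n) → J.card ≤ rankExpansion A k := by
  obtain ⟨e₀⟩ : Nonempty (Fin k ↪ n) :=
    Function.Embedding.nonempty_of_card_le (by simpa using hk)
  have hne : ((fun P : Matrix n (Fin k) ℂ => (A * P).rank) '' columnSelections n k).Nonempty :=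
    ⟨_, _, ⟨e₀, rfl⟩, rfl⟩
  obtain ⟨_, ⟨e, rfl⟩, he⟩ := Nat.sInf_mem hne
  refine ⟨Finset.univ.map e, by simp, fun J hJ hind => ?_⟩
  have he' : rankExpansion A k = (A.submatrix id e).rank :=
    he.symm.trans (congrArg Matrix.rank (mul_one_submatrix A e))
  rw [he', Matrix.rank_eq_finrank_span_cols]
  have hcard := finrank_span_eq_card hind.linearIndependent
  simp only [Finset.coe_sort_coe, Fintype.card_coe] at hcard
  rw [← hcard]
  have : Module.Finite ℂ (Submodule.span ℂ (Set.range (A.submatrix id e).col)) :=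
    Module.Finite.span_of_finite ℂ (Set.finite_range _)
  refine Submodule.finrank_mono (Submodule.span_mono ?_)
  rintro _ ⟨⟨i, hi⟩, rfl⟩
  obtain ⟨t, -, rfl⟩ := Finset.mem_map.1 (hJ hi)
  exact ⟨t, rfl⟩

lemma exists_linearIndepOn_span {n V : Type*} [Finite n] [AddCommGroup V] [Module ℂ V] (v : n → V)
    (X : Finset n) : ∃ J ⊆ X, LinearIndepOn ℂ v (J : Set n) ∧
      v '' X ⊆ Submodule.span ℂ (v '' J) := by
  obtain ⟨J, hJX, -, hspan, hind⟩ :=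
    exists_linearIndepOn_extension (linearIndepOn_empty ℂ v) (Set.empty_subset (X : Set n))
  lift J to Finset n using J.toFinite
  exact ⟨J, by exact_mod_cast hJX, hind, hspan⟩

/-- One independent family contains a spanning family of every superlevel set of `s`. It is grown
through the superlevel sets, from the highest level downwards. -/
lemma exists_linearIndepOn_span_superlevel {n V : Type*} [Fintype n] [AddCommGroup V] [Module ℂ V]
    (v : n → V) (s : n → ℕ) : ∃ I : Finset n, (∀ i ∈ I, 0 < s i) ∧
      LinearIndepOn ℂ v (I : Set n) ∧
      ∀ y, v '' {i | y < s i} ⊆ Submodule.span ℂ (v '' (I.filter (y < s ·) : Finset n)) := by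
  suffices h : ∀ l : ℕ, ∃ I : Set n, (∀ i ∈ I, l < s i) ∧ LinearIndepOn ℂ v I ∧
      ∀ y, l ≤ y → v '' {i | y < s i} ⊆ Submodule.span ℂ (v '' {i ∈ I | y < s i}) by
    obtain ⟨I, h1, h2, h3⟩ := h 0
    lift I to Finset n using I.toFinite
    exact ⟨I, h1, h2, fun y => by simpa using h3 y (Nat.zero_le _)⟩
  suffices h : ∀ d l : ℕ, Finset.univ.sup s ≤ l + d → ∃ I : Set n, (∀ i ∈ I, l < s i) ∧
      LinearIndepOn ℂ v I ∧
      ∀ y, l ≤ y → v '' {i | y < s i} ⊆ Submodule.span ℂ (v '' {i ∈ I | y < s i}) from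
    fun l => h _ l (Nat.le_add_left _ _)
  intro d
  induction d with
  | zero =>
    refine fun l hl => ⟨∅, by simp, linearIndepOn_empty ℂ v, fun y hy => ?_⟩
    rintro _ ⟨i, hi, rfl⟩
    have : s i ≤ Finset.univ.sup s := Finset.le_sup (Finset.mem_univ i)
    have : y < s i := hi
    omega
  | succ d ih =>
    intro l hl
    obtain ⟨I, h1, h2, h3⟩ := ih (l + 1) (by omega)
    obtain ⟨J, hJ, hIJ, hspan, hind⟩ :=
      exists_linearIndepOn_extension h2 (t := {i | l < s i})
        (fun i hi => (Nat.lt_succ_self l).trans (h1 i hi))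
    refine ⟨J, hJ, hind, fun y hy => ?_⟩
    rcases hy.eq_or_lt with rfl | hy
    · exact hspan.trans (Submodule.span_mono (Set.image_mono fun i hi => ⟨hi, hJ hi⟩))
    · exact (h3 y hy).trans (Submodule.span_mono (Set.image_mono fun i hi => ⟨hIJ hi.1, hi.2⟩))

/-- Tensoring independent columns of `A` each with its own independent family of columns of `B`
gives independent columns of `A ⊗ B`. -/
lemma linearIndepOn_kronecker_col {m n m' n' : Type*} (A : Matrix m n ℂ) (B : Matrix m' n' ℂ)
    (I : Finset n) (J : n → Finset n') (hI : LinearIndepOn ℂ A.col (I : Set n))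
    (hJ : ∀ i ∈ I, LinearIndepOn ℂ B.col (J i : Set n')) :
    LinearIndepOn ℂ (A ⊗ₖ B).col
      (((I.sigma J).map (Equiv.sigmaEquivProd n n').toEmbedding : Finset (n × n')) :
        Set (n × n')) := by
  rw [linearIndepOn_finset_iff]
  intro c hc
  rw [Finset.sum_map, Finset.sum_sigma] at hc
  have key : ∀ q, ∀ i ∈ I, ∑ j ∈ J i, c (i, j) * B q j = 0 := by
    intro q
    refine linearIndepOn_finset_iff.1 hI (fun i => ∑ j ∈ J i, c (i, j) * B q j) ?_
    ext p
    have := congrFun hc (p, q)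
    simp only [Finset.sum_apply, Pi.smul_apply, smul_eq_mul, Pi.zero_apply, Matrix.col_apply,
      Finset.sum_mul] at this ⊢
    rw [← this]
    refine Finset.sum_congr rfl fun i _ => Finset.sum_congr rfl fun j _ => ?_
    simp [Matrix.kroneckerMap_apply]
    ring
  intro z hz
  obtain ⟨⟨i, j⟩, hij, rfl⟩ := Finset.mem_map.1 hz
  obtain ⟨hi, hj⟩ := Finset.mem_sigma.1 hij
  refine linearIndepOn_finset_iff.1 (hJ i hi) (fun j => c (i, j)) ?_ j hj
  ext q
  simpa using key q i hi

/-- Since ranks are integers, a family of columns spanning those in a nonempty set `X` has at least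
`max 1 (σ #X)` members, which is `σ (max #X d)` when `σ d = 1`. -/
lemma IsRankExpansionLowerBound.apply_max_le_card {m n : Type*} [Fintype n] [DecidableEq n]
    {A : Matrix m n ℂ} {σ : ℝ → ℝ} (hA : IsRankExpansionLowerBound A σ)
    (hconc : ConcaveOn ℝ (Set.Ici 0) σ) (h0 : σ 0 = 0) {d : ℝ} (hd : 0 < d) (hσd : σ d = 1)
    {X J : Finset n} (hX : X.Nonempty)
    (h : A.col '' X ⊆ Submodule.span ℂ (A.col '' J)) : σ (max (X.card : ℝ) d) ≤ J.card := by
  have hσ : σ X.card ≤ J.card := (hA.le_rankExpansion _ hX.card_pos X.card_le_univ).trans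
    (by exact_mod_cast rankExpansion_card_le A X J h)
  rcases le_total (X.card : ℝ) d with hc | hc
  · rw [max_eq_right hc, hσd]
    have : 0 < σ X.card :=
      hconc.pos_of_apply_eq_one hA.monotoneOn h0 hd hσd (by exact_mod_cast hX.card_pos)
    have : (0 : ℝ) < J.card := this.trans_le hσ
    exact_mod_cast this
  · rwa [max_eq_left hc]

/-! ### The Kronecker product -/

/-- Any bound valid for the rectangles of area at least `k` is valid for the rank expansion of
`A ⊗ B` at `k`. The selected columns form a set `S` of pairs; its rows are the steps of a staircase,
restricted to the indices of an independent family of columns of `A`. -/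
lemma le_rankExpansion_kronecker {m n m' n' : Type*} [Fintype n] [DecidableEq n] [Fintype n']
    [DecidableEq n'] {A : Matrix m n ℂ} {B : Matrix m' n' ℂ} {f g : ℝ → ℝ}
    (hA : IsRankExpansionLowerBound A f) (hB : IsRankExpansionLowerBound B g)
    (hf : ConcaveOn ℝ (Set.Ici 0) f) (hg : ConcaveOn ℝ (Set.Ici 0) g)
    (hf0 : f 0 = 0) (hg0 : g 0 = 0) {a b : ℝ} (ha : 0 < a) (hb : 0 < b)
    (hfa : f a = 1) (hgb : g b = 1) {k : ℕ} (hk1 : 1 ≤ k) (hk : k ≤ Fintype.card (n × n')) {M : ℝ}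
    (hM : ∀ u v, a ≤ u → b ≤ v → (k : ℝ) ≤ u * v → M ≤ f u * g v) :
    M ≤ rankExpansion (A ⊗ₖ B) k := by
  obtain ⟨S, hS, hrank⟩ := exists_finset_card_le_rankExpansion (A ⊗ₖ B) hk
  let row : n → Finset n' := fun i => Finset.univ.filter fun j => (i, j) ∈ S
  let s : n → ℕ := fun i => (row i).card
  have hsum : ∑ i, s i = k := by
    rw [← hS, ← Finset.card_sigma]
    refine Finset.card_bij (fun z _ => (z.1, z.2)) ?_ ?_ ?_
    · rintro ⟨i, j⟩ h
      simpa [row] using h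
    · rintro ⟨i, j⟩ - ⟨i', j'⟩ - h
      simpa using h
    · rintro ⟨i, j⟩ h
      exact ⟨⟨i, j⟩, by simpa [row] using h, rfl⟩
  obtain ⟨I, hIpos, hIind, hIspan⟩ := exists_linearIndepOn_span_superlevel A.col s
  choose J hJrow hJind hJspan using fun i => exists_linearIndepOn_span B.col (row i)
  have hcard : ∑ i ∈ I, (J i).card ≤ rankExpansion (A ⊗ₖ B) k := by
    have := hrank _ ?_ (linearIndepOn_kronecker_col A B I J hIind fun i _ => hJind i)
    · rwa [Finset.card_map, Finset.card_sigma] at this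
    · intro z hz
      obtain ⟨⟨i, j⟩, hij, rfl⟩ := Finset.mem_map.1 hz
      simpa [row] using hJrow i (Finset.mem_sigma.1 hij).2
  have hJcard : ∀ i ∈ I, g (max (s i : ℝ) b) ≤ (J i).card := fun i hi =>
    hB.apply_max_le_card hg hg0 hb hgb (Finset.card_pos.1 (hIpos i hi)) (hJspan i)
  refine le_trans ?_ ((Finset.sum_le_sum hJcard).trans (by exact_mod_cast hcard))
  set H := Finset.univ.sup s with hH_def
  have hsH : ∀ i, s i ≤ H := fun i => Finset.le_sup (Finset.mem_univ i)
  have hH : 0 < H := by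
    by_contra! h
    have : ∑ i, s i = 0 := Finset.sum_eq_zero fun i _ => by have := hsH i; omega
    omega
  let L : ℕ → Finset n := fun y => Finset.univ.filter (y < s ·)
  have hLne : ∀ y < H, (L y).Nonempty := fun y hy => by
    obtain ⟨i, -, hi⟩ := Finset.lt_sup_iff.1 hy
    exact ⟨i, by simpa [L] using hi⟩
  have hL0 : ∀ y, L y ⊆ L 0 := fun y i hi => by
    simp only [L, Finset.mem_filter, Finset.mem_univ, true_and] at hi ⊢
    omega
  refine le_cost_staircase hf hg hB.monotoneOn ha hb hfa hgb hM I s hH (fun i _ => hsH i)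
    (fun y => max ((L y).card : ℝ) a) (fun y _ => le_max_right _ _)
    (fun y _ => max_le_max_right _ (by exact_mod_cast Finset.card_le_card (hL0 y)))
    (fun y hy => hA.apply_max_le_card hf hf0 ha hfa (hLne y hy) (by simpa [L] using hIspan y)) ?_
  -- Raising every nonempty row to height `b` and every layer to width `a` only adds area.
  calc (k : ℝ) = ∑ i, (s i : ℝ) := by rw [← hsum]; push_cast; rfl
    _ = ∑ i ∈ L 0, (s i : ℝ) := by
      refine (Finset.sum_subset (Finset.subset_univ _) fun i _ hi => ?_).symm
      have : s i = 0 := by simpa [L] using hi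
      exact_mod_cast this
    _ ≤ ∑ i ∈ L 0, max (s i : ℝ) b := Finset.sum_le_sum fun i _ => le_max_left _ _
    _ = b * (L 0).card + ∑ y ∈ Finset.range H,
          (max ((y + 1 : ℕ) : ℝ) b - max (y : ℝ) b) * (L y).card := by
      rw [Finset.sum_congr rfl fun i _ => max_eq_add_sum_layers hb.le (hsH i),
        Finset.sum_add_distrib, Finset.sum_comm]
      simp only [← Finset.sum_filter, Finset.sum_const, nsmul_eq_mul]
      rw [mul_comm]
      congr 1
      refine Finset.sum_congr rfl fun y _ => ?_
      have : (L 0).filter (y < s ·) = L y := by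
        ext i
        simp only [L, Finset.mem_filter, Finset.mem_univ, true_and]
        omega
      rw [this, mul_comm]
    _ ≤ _ := by
      refine add_le_add (mul_le_mul_of_nonneg_left (le_max_left _ _) hb.le)
        (Finset.sum_le_sum fun y _ => mul_le_mul_of_nonneg_left (le_max_left _ _)
          (sub_nonneg.2 (max_le_max_right _ (by simp))))

/-! ### The minimum over rectangles -/

/-- Below any `K`, the minimum is attained and agrees with a continuous function of `k`. Only
widths up to `max a (K / b)` matter, with `a = f†(1)` and `b = g†(1)`, and the least admissible
height for the width `u` is `max b (k / u)`. -/
lemma exists_continuous_isLeast_kroneckerValues {f g : ℝ → ℝ} (hf : ContinuousOn f (Set.Ici 0))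
    (hg : ContinuousOn g (Set.Ici 0)) (hf_mono : MonotoneOn f (Set.Ici 0))
    (hg_mono : MonotoneOn g (Set.Ici 0)) (hf_nonneg : ∀ x, 0 ≤ x → 0 ≤ f x)
    (hg_nonneg : ∀ x, 0 ≤ x → 0 ≤ g x)
    (ha : 0 < pseudoinverse f 1) (hb : 0 < pseudoinverse g 1) (K : ℝ) :
    ∃ F : ℝ → ℝ, Continuous F ∧ ∀ k ≤ K, IsLeast (kroneckerValues f g k) (F k) := by
  set a := pseudoinverse f 1 with ha_def
  set b := pseudoinverse g 1 with hb_def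
  set R := max a (K / b) with hR
  -- `max a u` is `u` on the interval of widths; it makes `Φ` continuous on the whole plane.
  let Φ : ℝ → ℝ → ℝ := fun k u => f (max a u) * g (max b (k / max a u))
  have hpos : ∀ u, 0 < max a u := fun u => lt_max_of_lt_left ha
  have hΦ : Continuous (Function.uncurry Φ) := by
    refine Continuous.mul ?_ ?_
    · exact hf.comp_continuous (continuous_const.max continuous_snd) fun z => (hpos z.2).le
    · refine hg.comp_continuous (continuous_const.max (continuous_fst.div
        (continuous_const.max continuous_snd) fun z => (hpos z.2).ne'))
        fun z => hb.le.trans (le_max_left _ _)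
  refine ⟨fun k => sInf (Φ k '' Set.Icc a R), isCompact_Icc.continuous_sInf hΦ, fun k hk => ?_⟩
  have hcont : Continuous (Φ k) := hΦ.comp (Continuous.prodMk_right k)
  have hleast : IsLeast (Φ k '' Set.Icc a R) (sInf (Φ k '' Set.Icc a R)) :=
    (isCompact_Icc.image hcont).isLeast_sInf ((Set.nonempty_Icc.2 (le_max_left _ _)).image _)
  refine ⟨?_, ?_⟩
  · obtain ⟨u, hu, hval⟩ := hleast.1
    refine ⟨max a u, max b (k / max a u), le_max_left _ _, le_max_left _ _, ?_, hval.symm⟩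
    have := mul_le_mul_of_nonneg_left (le_max_right b (k / max a u)) (hpos u).le
    rwa [mul_div_cancel₀ _ (hpos u).ne'] at this
  · rintro _ ⟨u, v, hu, hv, huv, rfl⟩
    have hu0 : 0 < u := ha.trans_le hu
    have hv0 : 0 < v := hb.trans_le hv
    have hmin : a ≤ min u R := le_min hu (le_max_left _ _)
    refine (hleast.2 ⟨min u R, ⟨hmin, min_le_right _ _⟩, rfl⟩).trans ?_
    simp only [Φ, max_eq_right hmin]
    have hheight : max b (k / min u R) ≤ v := by
      refine max_le hv ((div_le_iff₀ (ha.trans_le hmin)).2 ?_)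
      rcases le_total u R with h | h
      · rwa [min_eq_left h, mul_comm]
      -- Here `R ≥ K / b`, so the height `b` alone gives area at least `K`.
      · rw [min_eq_right h]
        have h1 : K ≤ R * b := (div_le_iff₀ hb).1 (le_max_right _ _)
        have h2 : R * b ≤ R * v :=
          mul_le_mul_of_nonneg_left hv (ha.le.trans (le_max_left _ _))
        linarith
    exact mul_le_mul
      (hf_mono (ha.le.trans hmin) hu0.le (min_le_left _ _))
      (hg_mono (hb.le.trans (le_max_left _ _)) hv0.le hheight)
      (hg_nonneg _ (hb.le.trans (le_max_left _ _))) (hf_nonneg _ hu0.le)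

theorem theorem1 {mA nA mB nB : ℕ}
    (A : Matrix (Fin mA) (Fin nA) ℂ) (B : Matrix (Fin mB) (Fin nB) ℂ) (σA σB : ℝ → ℝ)
    (hA : IsRankExpansionLowerBound A σA) (hB : IsRankExpansionLowerBound B σB)
    (hA_concave : ConcaveOn ℝ (Set.Ici 0) σA) (hB_concave : ConcaveOn ℝ (Set.Ici 0) σB)
    (hA_zero : σA 0 = 0) (hB_zero : σB 0 = 0)
    (hA_finite : BddAbove (sublevel σA 1)) (hB_finite : BddAbove (sublevel σB 1)) :
    (∀ k : ℝ, 0 ≤ k → IsLeast (kroneckerValues σA σB k) (kroneckerBound σA σB k)) ∧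
      IsRankExpansionLowerBound (A ⊗ₖ B) (kroneckerBound σA σB) := by
  obtain ⟨ha, hfa⟩ := apply_pseudoinverse_one hA.continuousOn hA_zero hA_finite
  obtain ⟨hb, hgb⟩ := apply_pseudoinverse_one hB.continuousOn hB_zero hB_finite
  have hF := exists_continuous_isLeast_kroneckerValues hA.continuousOn hB.continuousOn
    hA.monotoneOn hB.monotoneOn hA.nonneg hB.nonneg ha hb
  have hleast : ∀ k, IsLeast (kroneckerValues σA σB k) (kroneckerBound σA σB k) := fun k => by
    obtain ⟨F, -, hF⟩ := hF k
    rw [kroneckerBound, (hF k le_rfl).csInf_eq]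
    exact hF k le_rfl
  refine ⟨fun k _ => hleast k, ⟨?_, ?_, ?_, ?_⟩⟩
  · refine Continuous.continuousOn (continuous_iff_continuousAt.2 fun x => ?_)
    obtain ⟨F, hFcont, hF⟩ := hF (x + 1)
    refine hFcont.continuousAt.congr ?_
    filter_upwards [Iio_mem_nhds (lt_add_one x)] with k hk
    exact (hF k (le_of_lt hk)).unique (hleast k)
  · intro x _
    obtain ⟨u, v, hu, hv, -, h⟩ := (hleast x).1
    rw [h]
    exact mul_nonneg (hA.nonneg u (ha.le.trans hu)) (hB.nonneg v (hb.le.trans hv))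
  · intro x _ y _ hxy
    obtain ⟨u, v, hu, hv, huv, h⟩ := (hleast y).1
    exact (hleast x).2 ⟨u, v, hu, hv, hxy.trans huv, h⟩
  · intro k hk1 hk
    exact le_rankExpansion_kronecker hA hB hA_concave hB_concave hA_zero hB_zero ha hb hfa hgb
      hk1 hk fun u v hu hv huv => (hleast k).2 ⟨u, v, hu, hv, huv, rfl⟩
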